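/- Let $A$ be an Artin algebra, i.e. an algebra that is finitely generated as a module over a commutative Artinian ring. A finitely generated left $A$-module $M$ is called Gorenstein projective if $M\cong\operatorname{Im}(P_0\to P^0)$ for some exact complex $\cdots\to P_1\to P_0\to P^0\to P^1\to\cdots$ of finitely generated projective left $A$-modules that remains exact under $\operatorname{Hom}_A(-,Q)$ for every finitely generated projective left $A$-module $Q$. Let $\mathcal{GP}(A)$ be the class of all Gorenstein projective $A$-modules, and for a module $E$ let $\operatorname{add}E$ be the class of all direct summands of finite direct sums of copies of $E$. Let $n\ge 2$ and suppose that $A$ is $n$-Gorenstein, i.e. $A$ is left and right Noetherian, $\operatorname{id}({}_AA)\le n$ and $\operatorname{id}(A_A)<\infty$. Suppose that $\mathcal{GP}(A)=\operatorname{add}E$ for a finitely generated left $A$-module $E$ (so that $A$ is CM-finite). Let $M$ be a Gorenstein projective left $A$-module and let $B=\operatorname{End}_A M$, with endomorphisms written on the right, so that $M$ is an $A$-$B$-bimodule and $\operatorname{Hom}_A(M,E)$ is a left $B$-module. Then $$\operatorname{gl.dim} B\le n+\operatorname{pd}_B\operatorname{Hom}_A(M,E),$$ where $\operatorname{gl.dim}B$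 is the supremum of the projective dimensions of all left $B$-modules, the zero module has projective dimension $-\infty$, and the right-hand side may be infinite. -/

import Mathlib

open CategoryTheory

universe w u

/-- An exact complex `⋯ → P (-2) → P (-1) → P 0 → P 1 → ⋯` of finitely generated projective left
`A`-modules which stays exact under `Hom_A(-, Q)` for every finitely generated projective
left `A`-module `Q`, together with an isomorphism of `M` with the image of `P (-1) → P 0`. -/
structure CompleteProjectiveResolution (A : Type u) [Ring A] (M : Type u) [AddCommGroup M]
    [Module A M] where
  /-- the terms of the complex -/
  P : ℤ → Type u
  [addCommGroup : ∀ i, AddCommGroup (P i)]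
  [module : ∀ i, Module A (P i)]
  finite : ∀ i, Module.Finite A (P i)
  projective : ∀ i, Module.Projective A (P i)
  /-- the differential -/
  d : ∀ i, P i →ₗ[A] P (i + 1)
  exact : ∀ i, Function.Exact (d i) (d (i + 1))
  hom_exact : ∀ (Q : Type u) [AddCommGroup Q] [Module A Q] [Module.Finite A Q]
    [Module.Projective A Q] (i : ℤ),
    Function.Exact (fun g : P (i + 1 + 1) →ₗ[A] Q => g ∘ₗ d (i + 1))
      (fun g : P (i + 1) →ₗ[A] Q => g ∘ₗ d i)
  /-- the identification of `M` with the image of `P (-1) → P 0` -/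
  iso : M ≃ₗ[A] LinearMap.range (d (-1))

/-- `M` is a (finitely generated) Gorenstein projective left `A`-module. -/
def IsGorensteinProjective (A : Type u) [Ring A] (M : Type u) [AddCommGroup M]
    [Module A M] : Prop :=
  Nonempty (CompleteProjectiveResolution A M)

/-- `X` belongs to `add E`: it is a direct summand of a finite direct sum of copies of `E`. -/
def IsInAdd (A : Type u) [Ring A] (E : Type u) [AddCommGroup E] [Module A E]
    (X : Type u) [AddCommGroup X] [Module A X] : Prop :=
  ∃ (k : ℕ) (Y : ModuleCat.{u} A), Nonempty ((X × Y) ≃ₗ[A] (Fin k → E))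

/-- `GP(A) = add E`: the finitely generated Gorenstein projective left `A`-modules are
exactly the modules in `add E`. -/
def GorensteinProjectivesEqAdd (A : Type u) [Ring A] (E : Type u) [AddCommGroup E]
    [Module A E] : Prop :=
  ∀ (X : Type u) [AddCommGroup X] [Module A X] [Module.Finite A X],
    IsGorensteinProjective A X ↔ IsInAdd A E X

/-- A Gorenstein ring: left and right Noetherian, of finite injective dimension as a left and
as a right module over itself (right modules are modules over the opposite ring). -/
structure IsGorensteinRing (A : Type u) [Ring A] : Prop where
  noetherian_left : IsNoetherianRing A
  noetherian_right : IsNoetherianRing Aᵐᵒᵖ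
  injdim_left : ∃ m : ℕ, HasInjectiveDimensionLE (ModuleCat.of A A) m
  injdim_right : ∃ m : ℕ, HasInjectiveDimensionLE (ModuleCat.of Aᵐᵒᵖ A) m

/-- An `n`-Gorenstein ring: a Gorenstein ring `A` with `id (_A A) ≤ n`. -/
structure IsNGorensteinRing (n : ℕ) (A : Type u) [Ring A] : Prop extends IsGorensteinRing A where
  injdim_le : HasInjectiveDimensionLE (ModuleCat.of A A) n

/-- The (left) global dimension of a ring: the supremum of the projective dimensions of all left
modules. As for the projective dimension in Mathlib, zero modules have dimension `⊥`. -/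
noncomputable def globalDimension (B : Type u) [Ring B] : WithBot ℕ∞ :=
  ⨆ X : ModuleCat.{u} B, projectiveDimension X

/-- The endomorphism ring of a left `A`-module `M` with endomorphisms written on the right, so that
`M` is an `A`-`B`-bimodule, the product `b * c` is "first `b`, then `c`", and
`Hom_A(M, E)` is a left module by precomposition, `(b • f) m = f (m b)`. As a ring it is
the opposite of `Module.End A M`. -/
abbrev RightEnd (A : Type u) [Ring A] (M : Type u) [AddCommGroup M] [Module A M] : Type u :=
  DomMulAct (Module.End A M)

/-!
Let `B = RightEnd A M`. By Auslander's theorem it suffices to bound `pd (B ⧸ I)` for left ideals `I`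
(`globalDimension_le_of_cyclic`). As `A` is an Artin algebra, `B` is Noetherian
(`fg_submodule_end`), so `I ⊆ Hom_A(M, M)` is the image of `Hom_A(M, M^k)` under some map
`β : M^k → M`, with kernel `Hom_A(M, K)` for `K = ker β` (`exists_isShortExactSeq_of_fg`); hence
`pd (B ⧸ I) ≤ 2 + max (pd Hom_A(M, K)) (pd Hom_A(M, E))`, and it remains to see that
`pd Hom_A(M, K) ≤ (n - 2) + pd Hom_A(M, E)`.

The module `K` is a second syzygy of `coker β` up to the Gorenstein projective modules `M^k` and
`M`, so `Ext^i(K, A) = 0` for `i > n - 2` because `id A ≤ n`. Such a module has an approximation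
`0 → Y → G → K → 0` with `G` Gorenstein projective and `Y` having a free resolution of length
`n - 2` (`exists_approximation`). Both sequences remain exact under `Hom_A(M, -)`, because `Ext^i(M, A) = 0`
for `i > 0`, and `Hom_A(M, -)` takes `G` and the free modules, all of them in `add E`, to summands
of powers of `Hom_A(M, E)`.

The remaining point is that over a Gorenstein ring the Gorenstein projective modules are precisely
the finitely generated `X` with `Ext^i(X, A) = 0` for all `i > 0`. Such an `X` is torsionless: the
dual of a free resolution of `X` is an exact sequence of projective right modules, which stays exact
under a second dualization as the right injective dimension of `A` is finite
(`exists_extension_of_hasInjectiveDimensionLE`). So generators of the dual of `X` embed `X` into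
`A^k`, with a cokernel of the same kind, and iterating on both sides gives a complete resolution.
-/

/-! ### Short exact sequences, `Ext` vanishing and homological dimensions -/

/-- The sequence `0 → X₁ → X₂ → X₃ → 0` of `A`-modules is exact. -/
structure IsShortExactSeq {A : Type u} [Ring A] {X₁ X₂ X₃ : Type u}
    [AddCommGroup X₁] [Module A X₁] [AddCommGroup X₂] [Module A X₂] [AddCommGroup X₃] [Module A X₃]
    (f : X₁ →ₗ[A] X₂) (g : X₂ →ₗ[A] X₃) : Prop where
  injective : Function.Injective f
  exact : Function.Exact f g
  surjective : Function.Surjective g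

/-- `Ext^i_A(X, Y) = 0` for all `i > d`. -/
def ExtVanishesAbove (A : Type u) [Ring A] (X Y : Type u) [AddCommGroup X] [Module A X]
    [AddCommGroup Y] [Module A Y] (d : ℕ) : Prop :=
  ∀ i : ℕ, d < i → ∀ e : Abelian.Ext (ModuleCat.of A X) (ModuleCat.of A Y) i, e = 0

section

open Abelian

variable {A : Type u} [Ring A] {X₁ X₂ X₃ Y : Type u}
    [AddCommGroup X₁] [Module A X₁] [AddCommGroup X₂] [Module A X₂] [AddCommGroup X₃] [Module A X₃]
    [AddCommGroup Y] [Module A Y] {f : X₁ →ₗ[A] X₂} {g : X₂ →ₗ[A] X₃}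

lemma IsShortExactSeq.comp_eq_zero (h : IsShortExactSeq f g) :
    ModuleCat.ofHom f ≫ ModuleCat.ofHom g = 0 := by
  ext x
  exact h.exact.apply_apply_eq_zero x

lemma IsShortExactSeq.shortExact (h : IsShortExactSeq f g) :
    (ShortComplex.mk (ModuleCat.ofHom f) (ModuleCat.ofHom g) h.comp_eq_zero).ShortExact :=
  ModuleCat.shortComplex_shortExact _ h.exact h.injective h.surjective

lemma isShortExactSeq_ker_subtype (hg : Function.Surjective g) :
    IsShortExactSeq (LinearMap.ker g).subtype g :=
  ⟨Subtype.val_injective, LinearMap.exact_subtype_ker_map g, hg⟩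

lemma isShortExactSeq_range_mkQ (hf : Function.Injective f) :
    IsShortExactSeq f (LinearMap.range f).mkQ :=
  ⟨hf, LinearMap.exact_map_mkQ_range f, Submodule.mkQ_surjective _⟩

lemma isShortExactSeq_subtype_mkQ (N : Submodule A Y) : IsShortExactSeq N.subtype N.mkQ :=
  ⟨N.injective_subtype, LinearMap.exact_subtype_mkQ N, N.mkQ_surjective⟩

lemma IsShortExactSeq.exists_desc (h : IsShortExactSeq f g) (φ : X₂ →ₗ[A] Y)
    (hφ : φ ∘ₗ f = 0) : ∃ ψ : X₃ →ₗ[A] Y, ψ ∘ₗ g = φ := by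
  refine ⟨(LinearMap.ker g).liftQ φ ?_ ∘ₗ (g.quotKerEquivOfSurjective h.surjective).symm, ?_⟩
  · intro x hx
    obtain ⟨y, rfl⟩ := (h.exact x).1 hx
    exact LinearMap.congr_fun hφ y
  · ext x
    have : (g.quotKerEquivOfSurjective h.surjective).symm (g x) = (LinearMap.ker g).mkQ x := by
      rw [LinearEquiv.symm_apply_eq]; rfl
    simp [this]

lemma IsShortExactSeq.exists_lift (h : IsShortExactSeq f g) (φ : Y →ₗ[A] X₂)
    (hφ : g ∘ₗ φ = 0) : ∃ ψ : Y →ₗ[A] X₁, f ∘ₗ ψ = φ := by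
  have hr : ∀ y, φ y ∈ LinearMap.range f := fun y =>
    (h.exact (φ y)).1 (LinearMap.congr_fun hφ y)
  refine ⟨(LinearEquiv.ofInjective f h.injective).symm.toLinearMap ∘ₗ φ.codRestrict _ hr, ?_⟩
  ext y
  have := LinearEquiv.apply_symm_apply (LinearEquiv.ofInjective f h.injective)
    (φ.codRestrict _ hr y)
  exact congrArg Subtype.val this

lemma ExtVanishesAbove.mono {d e : ℕ} (h : ExtVanishesAbove A X₁ Y d) (hde : d ≤ e) :
    ExtVanishesAbove A X₁ Y e :=
  fun i hi => h i (hde.trans_lt hi)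

lemma ExtVanishesAbove.of_projective [Module.Projective A X₁] (d : ℕ) :
    ExtVanishesAbove A X₁ Y d := by
  intro i hi e
  have : Projective (ModuleCat.of A X₁) := (IsProjective.iff_projective X₁).1 inferInstance
  exact e.eq_zero_of_hasProjectiveDimensionLT 1 (by lia)

lemma ExtVanishesAbove.of_injdim {d : ℕ} (h : HasInjectiveDimensionLE (ModuleCat.of A Y) d) :
    ExtVanishesAbove A X₁ Y d :=
  fun _ hi e => e.eq_zero_of_hasInjectiveDimensionLT (d + 1) hi

lemma IsShortExactSeq.extVanishesAbove_left (h : IsShortExactSeq f g) {d : ℕ}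
    (h₂ : ExtVanishesAbove A X₂ Y d) (h₃ : ExtVanishesAbove A X₃ Y (d + 1)) :
    ExtVanishesAbove A X₁ Y d := by
  intro i hi e
  obtain ⟨e', rfl⟩ := Ext.contravariant_sequence_exact₁ h.shortExact _ e (add_comm 1 i)
    (h₃ _ (by lia) _)
  rw [h₂ i hi e', Ext.comp_zero]

lemma IsShortExactSeq.ext_one_eq_zero (h : IsShortExactSeq f g) (h₂ : ExtVanishesAbove A X₂ Y 0)
    (hext : ∀ φ : X₁ →ₗ[A] Y, ∃ ψ : X₂ →ₗ[A] Y, ψ ∘ₗ f = φ)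
    (e : Ext (ModuleCat.of A X₃) (ModuleCat.of A Y) 1) : e = 0 := by
  obtain ⟨e', rfl⟩ := Ext.contravariant_sequence_exact₃ h.shortExact _ e
    (h₂ _ Nat.one_pos _) (add_zero 1)
  obtain ⟨φ, rfl⟩ := Ext.homEquiv₀.symm.surjective e'
  obtain ⟨ψ, hψ⟩ := hext φ.hom
  have : φ = ModuleCat.ofHom f ≫ ModuleCat.ofHom ψ := by
    ext x
    exact (LinearMap.congr_fun hψ x).symm
  rw [this, Ext.homEquiv₀_symm_apply, ← Ext.mk₀_comp_mk₀]
  exact h.shortExact.extClass_comp_assoc _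

lemma IsShortExactSeq.ext_succ_eq_zero (h : IsShortExactSeq f g)
    (h₂ : ExtVanishesAbove A X₂ Y 0) {n : ℕ}
    (h₁ : ∀ e : Ext (ModuleCat.of A X₁) (ModuleCat.of A Y) n, e = 0)
    (e : Ext (ModuleCat.of A X₃) (ModuleCat.of A Y) (n + 1)) : e = 0 := by
  obtain ⟨e', rfl⟩ := Ext.contravariant_sequence_exact₃ h.shortExact _ e
    (h₂ _ n.succ_pos _) (add_comm 1 n)
  rw [h₁ e', Ext.comp_zero]

lemma IsShortExactSeq.extVanishesAbove_right_zero (h : IsShortExactSeq f g)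
    (h₁ : ExtVanishesAbove A X₁ Y 0) (h₂ : ExtVanishesAbove A X₂ Y 0)
    (hext : ∀ φ : X₁ →ₗ[A] Y, ∃ ψ : X₂ →ₗ[A] Y, ψ ∘ₗ f = φ) :
    ExtVanishesAbove A X₃ Y 0
  | 1, _ => h.ext_one_eq_zero h₂ hext
  | n + 2, _ => h.ext_succ_eq_zero h₂ (h₁ (n + 1) n.succ_pos)

lemma IsShortExactSeq.exists_extension (h : IsShortExactSeq f g)
    (h₃ : ExtVanishesAbove A X₃ Y 0) (φ : X₁ →ₗ[A] Y) :
    ∃ ψ : X₂ →ₗ[A] Y, ψ ∘ₗ f = φ := by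
  obtain ⟨e, he⟩ := Ext.contravariant_sequence_exact₁ h.shortExact _
    (Ext.mk₀ (ModuleCat.ofHom φ)) (add_zero 1) (h₃ _ (by lia) _)
  obtain ⟨ψ, rfl⟩ := Ext.homEquiv₀.symm.surjective e
  refine ⟨ψ.hom, ?_⟩
  rw [Ext.homEquiv₀_symm_apply, Ext.mk₀_comp_mk₀] at he
  have := Ext.homEquiv₀.symm.injective he
  ext x
  exact congrArg (fun t => t.hom x) this

lemma IsShortExactSeq.exists_lifting (h : IsShortExactSeq f g)
    (h₁ : ExtVanishesAbove A Y X₁ 0) (φ : Y →ₗ[A] X₃) :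
    ∃ ψ : Y →ₗ[A] X₂, g ∘ₗ ψ = φ := by
  obtain ⟨e, he⟩ := Ext.covariant_sequence_exact₃ _ h.shortExact
    (Ext.mk₀ (ModuleCat.ofHom φ)) (zero_add 1) (h₁ _ (by lia) _)
  obtain ⟨ψ, rfl⟩ := Ext.homEquiv₀.symm.surjective e
  refine ⟨ψ.hom, ?_⟩
  rw [Ext.homEquiv₀_symm_apply, Ext.mk₀_comp_mk₀] at he
  have := Ext.homEquiv₀.symm.injective he
  ext x
  exact congrArg (fun t => t.hom x) this

lemma IsShortExactSeq.extVanishesAbove_target_right (h : IsShortExactSeq f g) {d : ℕ}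
    (h₁ : ExtVanishesAbove A Y X₁ d) (h₂ : ExtVanishesAbove A Y X₂ d) :
    ExtVanishesAbove A Y X₃ d := by
  intro i hi e
  obtain ⟨e', rfl⟩ := Ext.covariant_sequence_exact₃ _ h.shortExact e rfl (h₁ _ (by lia) _)
  rw [h₂ i hi e', Ext.zero_comp]

lemma IsShortExactSeq.extVanishesAbove_middle (h : IsShortExactSeq f g) {d : ℕ}
    (h₁ : ExtVanishesAbove A X₁ Y d) (h₃ : ExtVanishesAbove A X₃ Y d) :
    ExtVanishesAbove A X₂ Y d := by
  intro i hi e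
  obtain ⟨e', rfl⟩ := Ext.contravariant_sequence_exact₂ h.shortExact _ e (h₁ i hi _)
  rw [h₃ i hi e', Ext.comp_zero]

lemma IsShortExactSeq.extVanishesAbove_target_middle (h : IsShortExactSeq f g) {d : ℕ}
    (h₁ : ExtVanishesAbove A Y X₁ d) (h₃ : ExtVanishesAbove A Y X₃ d) :
    ExtVanishesAbove A Y X₂ d := by
  intro i hi e
  obtain ⟨e', rfl⟩ := Ext.covariant_sequence_exact₂ _ h.shortExact e (h₃ i hi _)
  rw [h₁ i hi e', Ext.zero_comp]

lemma ExtVanishesAbove.of_subsingleton_left [Subsingleton X₁] (d : ℕ) :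
    ExtVanishesAbove A X₁ Y d := by
  intro i _ e
  have : HasProjectiveDimensionLT (ModuleCat.of A X₁) 0 :=
    (ModuleCat.isZero_of_subsingleton _).hasProjectiveDimensionLT_zero
  exact e.eq_zero_of_hasProjectiveDimensionLT 0 (by lia)

lemma ExtVanishesAbove.of_subsingleton_right [Subsingleton Y] (d : ℕ) :
    ExtVanishesAbove A X₁ Y d := by
  intro i _ e
  have : HasInjectiveDimensionLT (ModuleCat.of A Y) 0 :=
    (ModuleCat.isZero_of_subsingleton _).hasInjectiveDimensionLT_zero
  exact e.eq_zero_of_hasInjectiveDimensionLT 0 (by lia)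

lemma ExtVanishesAbove.of_equiv_left (e : X₁ ≃ₗ[A] X₂) {d : ℕ}
    (h : ExtVanishesAbove A X₁ Y d) : ExtVanishesAbove A X₂ Y d := by
  intro i hi x
  have hid : (e.symm.toModuleIso.hom ≫ e.toModuleIso.hom) = 𝟙 (ModuleCat.of A X₂) := by
    ext; simp
  rw [← x.mk₀_id_comp, ← hid, ← Ext.mk₀_comp_mk₀_assoc, h i hi (Ext.comp _ x _), Ext.comp_zero]

/-- The split exact sequence `0 → E → E^(k+1) → E^k → 0`. -/
lemma isShortExactSeq_pi_succ (E : Type u) [AddCommGroup E] [Module A E] (k : ℕ) :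
    IsShortExactSeq (LinearMap.single A (fun _ : Fin (k + 1) => E) 0)
      (LinearMap.funLeft A E (Fin.succ : Fin k → Fin (k + 1))) := by
  refine ⟨Pi.single_injective (M := fun _ : Fin (k + 1) => E) 0, fun x => ⟨fun hx => ⟨x 0, ?_⟩, ?_⟩,
    fun y => ⟨Fin.cons 0 y, ?_⟩⟩
  · ext i
    refine Fin.cases (by simp) (fun j => ?_) i
    have := congrFun hx j
    simp [LinearMap.funLeft_apply] at this ⊢
    exact this.symm
  · rintro ⟨y, rfl⟩
    ext j
    simp [LinearMap.funLeft_apply]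
  · ext j
    simp [LinearMap.funLeft_apply]

lemma ExtVanishesAbove.pi_right {d : ℕ} (h : ExtVanishesAbove A X₁ Y d) (k : ℕ) :
    ExtVanishesAbove A X₁ (Fin k → Y) d := by
  induction k with
  | zero => exact .of_subsingleton_right d
  | succ k ih => exact (isShortExactSeq_pi_succ Y k).extVanishesAbove_target_middle h ih

lemma ExtVanishesAbove.pi_left {d : ℕ} (h : ExtVanishesAbove A X₁ Y d) (k : ℕ) :
    ExtVanishesAbove A (Fin k → X₁) Y d := by
  induction k with
  | zero => exact .of_subsingleton_left d
  | succ k ih => exact (isShortExactSeq_pi_succ X₁ k).extVanishesAbove_middle h ih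

lemma IsShortExactSeq.hasProjectiveDimensionLT_right (h : IsShortExactSeq f g) {d : ℕ}
    (h₁ : HasProjectiveDimensionLT (ModuleCat.of A X₁) d)
    (h₂ : HasProjectiveDimensionLT (ModuleCat.of A X₂) (d + 1)) :
    HasProjectiveDimensionLT (ModuleCat.of A X₃) (d + 1) :=
  h.shortExact.hasProjectiveDimensionLT_X₃ d h₁ h₂

lemma hasProjectiveDimensionLT_pi {d : ℕ} (h : HasProjectiveDimensionLT (ModuleCat.of A Y) d)
    (k : ℕ) : HasProjectiveDimensionLT (ModuleCat.of A (Fin k → Y)) d := by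
  induction k with
  | zero =>
    have : HasProjectiveDimensionLT (ModuleCat.of A (Fin 0 → Y)) 0 :=
      (ModuleCat.isZero_of_subsingleton _).hasProjectiveDimensionLT_zero
    exact hasProjectiveDimensionLT_of_ge _ 0 d (by lia)
  | succ k ih =>
    exact (isShortExactSeq_pi_succ Y k).shortExact.hasProjectiveDimensionLT_X₂ d h ih

end

section

open Abelian

/-- Let `F₀ → F₁ → F₂ → ⋯` be a sequence of projective modules which is exact at `F₁, F₂, …`.
If `N` has finite injective dimension, every map `F₀ → N` vanishing on the kernel of `F₀ → F₁`
factors through `F₁`. -/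
lemma exists_extension_of_hasInjectiveDimensionLE {S : Type u} [Ring S] (m : ℕ) :
    ∀ (N : ModuleCat.{u} S) (_ : HasInjectiveDimensionLE N m) (F : ℕ → ModuleCat.{u} S)
      (d : ∀ i, F i →ₗ[S] F (i + 1)) (_ : ∀ i, Module.Projective S (F i))
      (_ : ∀ i, Function.Exact (d i) (d (i + 1))) (g : F 0 →ₗ[S] N)
      (_ : LinearMap.ker (d 0) ≤ LinearMap.ker g), ∃ h : F 1 →ₗ[S] N, h ∘ₗ d 0 = g := by
  -- a map vanishing on the kernel of `p` extends along `p` when the target is injective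
  have key (N : ModuleCat.{u} S) [Injective N] {F₀ F₁ : ModuleCat.{u} S} (p : F₀ →ₗ[S] F₁)
      (g : F₀ →ₗ[S] N) (hg : LinearMap.ker p ≤ LinearMap.ker g) :
      ∃ h : F₁ →ₗ[S] N, h ∘ₗ p = g := by
    have hi : Module.Injective S N := Module.injective_module_of_injective_object S N
    let q : LinearMap.range p →ₗ[S] N :=
      (LinearMap.ker p).liftQ g hg ∘ₗ p.quotKerEquivRange.symm
    obtain ⟨h, hh⟩ := hi.out (LinearMap.range p).subtype (Submodule.injective_subtype _) q
    refine ⟨h, LinearMap.ext fun x => ?_⟩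
    have h1 := hh ⟨p x, LinearMap.mem_range_self p x⟩
    have h2 : p.quotKerEquivRange.symm ⟨p x, LinearMap.mem_range_self p x⟩ =
        (LinearMap.ker p).mkQ x := by
      rw [LinearEquiv.symm_apply_eq]; rfl
    rw [LinearMap.comp_apply]
    refine h1.trans ?_
    simp [q, h2]
  induction m with
  | zero =>
    intro N hN F d _ _ g hg
    have : Injective N := (injective_iff_hasInjectiveDimensionLT_one).2 hN
    exact key N (d 0) g hg
  | succ m ih =>
    intro N hN F d hP hd g hg
    obtain ⟨I, _, j, hj⟩ := EnoughInjectives.presentation N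
    have hj' : Function.Injective j.hom := (ModuleCat.mono_iff_injective j).1 hj
    have hs := isShortExactSeq_range_mkQ (f := j.hom) hj'
    have hN' : HasInjectiveDimensionLE (ModuleCat.of S (I ⧸ LinearMap.range j.hom)) m :=
      (hs.shortExact.hasInjectiveDimensionLT_X₃_iff m ‹_›).2 hN
    obtain ⟨h, hh⟩ := key I (d 0) (j.hom ∘ₗ g) (hg.trans (LinearMap.ker_le_ker_comp _ _))
    obtain ⟨k, hk⟩ := ih _ hN' (fun i => F (i + 1)) (fun i => d (i + 1)) (fun i => hP _)
      (fun i => hd _) ((LinearMap.range j.hom).mkQ ∘ₗ h) (by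
        intro x hx
        obtain ⟨y, rfl⟩ := (hd 0 x).1 hx
        have := LinearMap.congr_fun hh y
        simp only [LinearMap.comp_apply] at this
        simp [this])
    have := hP 2
    obtain ⟨l, hl⟩ := Module.projective_lifting_property _ k hs.surjective
    obtain ⟨r, hr⟩ := hs.exists_lift (h - l ∘ₗ d 1) (by
      ext x
      have h1 := LinearMap.congr_fun hk x
      have h2 := LinearMap.congr_fun hl (d 1 x)
      simp only [LinearMap.comp_apply] at h1 h2
      simp only [LinearMap.comp_apply, LinearMap.sub_apply, map_sub, LinearMap.zero_apply]
      exact sub_eq_zero.2 (h1.symm.trans h2.symm))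
    refine ⟨r, LinearMap.ext fun x => hj' ?_⟩
    have h1 := LinearMap.congr_fun hr (d 0 x)
    have h2 := LinearMap.congr_fun hh x
    have h3 : d 1 (d 0 x) = 0 := (hd 0).apply_apply_eq_zero x
    simp only [LinearMap.comp_apply, LinearMap.sub_apply] at h1 h2 ⊢
    rw [h1, h2, h3, map_zero, sub_zero]

/-- Baer's criterion in degree `N`: the injective dimension of `Y` is detected by cyclic modules. -/
lemma hasInjectiveDimensionLE_of_extVanishesAbove_quotient {B : Type u} [Ring B] (N : ℕ) :
    ∀ (Y : ModuleCat.{u} B) (_ : ∀ I : Submodule B B, ExtVanishesAbove B (B ⧸ I) Y N),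
      HasInjectiveDimensionLE Y N := by
  induction N with
  | zero =>
    intro Y hY
    refine (injective_iff_hasInjectiveDimensionLT_one).1 ?_
    refine (Module.injective_iff_injective_object B Y).1 (Module.Baer.injective fun I g => ?_)
    obtain ⟨h, hh⟩ := (isShortExactSeq_subtype_mkQ I).exists_extension (hY I) g
    exact ⟨h, fun x hx => LinearMap.congr_fun hh ⟨x, hx⟩⟩
  | succ N ih =>
    intro Y hY
    obtain ⟨J, hJ, j, hj⟩ := EnoughInjectives.presentation Y
    have hj' : Function.Injective j.hom := (ModuleCat.mono_iff_injective j).1 hj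
    have hs := isShortExactSeq_range_mkQ (f := j.hom) hj'
    refine (hs.shortExact.hasInjectiveDimensionLT_X₃_iff N hJ).1 (ih _ fun I i hi e => ?_)
    obtain ⟨e', rfl⟩ := Ext.covariant_sequence_exact₃ _ hs.shortExact e rfl (hY I _ (by lia) _)
    have : e' = 0 := by
      have : HasInjectiveDimensionLT J 1 := inferInstance
      exact e'.eq_zero_of_hasInjectiveDimensionLT 1 (by lia)
    rw [this, Ext.zero_comp]

/-- Auslander's theorem: the global dimension is detected by cyclic modules, which are here written
as quotients of any module `H` isomorphic to the regular one. -/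
lemma globalDimension_le_of_cyclic {B : Type u} [Ring B] {H : Type u} [AddCommGroup H] [Module B H]
    (e : B ≃ₗ[B] H) (N : ℕ)
    (h : ∀ I : Submodule B H, HasProjectiveDimensionLE (ModuleCat.of B (H ⧸ I)) N) :
    globalDimension B ≤ N := by
  have hcyc (I : Submodule B B) : HasProjectiveDimensionLE (ModuleCat.of B (B ⧸ I)) N :=
    have := h (I.map e.toLinearMap)
    hasProjectiveDimensionLT_of_iso
      (Submodule.Quotient.equiv I (I.map e.toLinearMap) e rfl).symm.toModuleIso _
  refine iSup_le fun X => (projectiveDimension_le_iff X N).2 (HasProjectiveDimensionLT.mk ?_)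
  intro i hi Y e
  have := hasInjectiveDimensionLE_of_extVanishesAbove_quotient N Y fun I i hi e =>
    have := hcyc I
    e.eq_zero_of_hasProjectiveDimensionLT (N + 1) hi
  exact e.eq_zero_of_hasInjectiveDimensionLT (N + 1) hi

end

/-! ### Semi-Gorenstein projective modules over a Gorenstein ring -/

/-- A finitely generated module `X` with `Ext^i_A(X, A) = 0` for all `i > 0`. Over a Gorenstein ring
these are the Gorenstein projective modules. -/
structure IsSemiGorensteinProjective (A : Type u) [Ring A] (X : Type u) [AddCommGroup X]
    [Module A X] : Prop where
  finite : Module.Finite A X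
  ext : ExtVanishesAbove A X A 0

/-- There is an exact sequence `0 → Z → A^k → Z' → 0` which stays exact under `Hom_A(-, A)`. -/
def IsSyzygyOf (A : Type u) [Ring A] (Z Z' : Type u) [AddCommGroup Z] [Module A Z]
    [AddCommGroup Z'] [Module A Z'] : Prop :=
  ∃ (k : ℕ) (f : Z →ₗ[A] (Fin k → A)) (g : (Fin k → A) →ₗ[A] Z'), IsShortExactSeq f g ∧
    ∀ φ : Z →ₗ[A] A, ∃ ψ : (Fin k → A) →ₗ[A] A, ψ ∘ₗ f = φ

section

variable {A : Type u} [Ring A]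

lemma isSemiGorensteinProjective_pi (k : ℕ) : IsSemiGorensteinProjective A (Fin k → A) :=
  ⟨inferInstance, .of_projective 0⟩

lemma IsSemiGorensteinProjective.exists_isSyzygyOf [IsNoetherianRing A] {X : Type u}
    [AddCommGroup X] [Module A X] (hX : IsSemiGorensteinProjective A X) :
    ∃ Z : ModuleCat.{u} A, IsSemiGorensteinProjective A Z ∧ IsSyzygyOf A Z X := by
  have := hX.finite
  obtain ⟨k, g, hg⟩ := Module.Finite.exists_fin' A X
  have hs := isShortExactSeq_ker_subtype hg
  exact ⟨ModuleCat.of A (LinearMap.ker g),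
    ⟨inferInstance, hs.extVanishesAbove_left (.of_projective 0) (hX.ext.mono zero_le_one)⟩,
    k, _, g, hs, hs.exists_extension hX.ext⟩

/-- An `A`-linear map `f` induces an `Aᵐᵒᵖ`-linear map between the `A`-duals. -/
def dualMapOp {X Y : Type u} [AddCommGroup X] [Module A X] [AddCommGroup Y] [Module A Y]
    (f : X →ₗ[A] Y) : (Y →ₗ[A] A) →ₗ[Aᵐᵒᵖ] (X →ₗ[A] A) where
  toFun φ := φ ∘ₗ f
  map_add' _ _ := rfl
  map_smul' _ _ := rfl

/-- Evaluation at `x`, as a map of right modules from the dual of `X` to `A`. -/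
def dualEval {X : Type u} [AddCommGroup X] [Module A X] (x : X) : (X →ₗ[A] A) →ₗ[Aᵐᵒᵖ] A where
  toFun φ := φ x
  map_add' _ _ := rfl
  map_smul' _ _ := rfl

/-- The ring `A`, as a right module over itself, is the regular module of `Aᵐᵒᵖ`. -/
def opLinearEquivSelf (A : Type u) [Ring A] : Aᵐᵒᵖ ≃ₗ[Aᵐᵒᵖ] A where
  toFun := MulOpposite.unop
  invFun := MulOpposite.op
  map_add' _ _ := rfl
  map_smul' _ _ := rfl

/-- The dual of a free module of rank `k` is free of rank `k` over the opposite ring. -/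
noncomputable def dualPiEquiv (A : Type u) [Ring A] (k : ℕ) :
    (Fin k → A) ≃ₗ[Aᵐᵒᵖ] ((Fin k → A) →ₗ[A] A) :=
  (Pi.basisFun A (Fin k)).constr Aᵐᵒᵖ

instance (k : ℕ) : Module.Projective Aᵐᵒᵖ ((Fin k → A) →ₗ[A] A) := by
  have : Module.Projective Aᵐᵒᵖ (Fin k → A) :=
    .of_equiv (LinearEquiv.piCongrRight fun _ => opLinearEquivSelf A)
  exact .of_equiv (dualPiEquiv A k)

lemma isNoetherian_dual [IsNoetherianRing Aᵐᵒᵖ] {X : Type u} [AddCommGroup X] [Module A X]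
    [Module.Finite A X] : IsNoetherian Aᵐᵒᵖ (X →ₗ[A] A) := by
  have : IsNoetherian Aᵐᵒᵖ A := isNoetherian_of_linearEquiv (opLinearEquivSelf A)
  obtain ⟨k, g, hg⟩ := Module.Finite.exists_fin' A X
  have : IsNoetherian Aᵐᵒᵖ ((Fin k → A) →ₗ[A] A) := isNoetherian_of_linearEquiv (dualPiEquiv A k)
  refine isNoetherian_of_injective (dualMapOp g) fun φ ψ h => LinearMap.ext fun x => ?_
  obtain ⟨y, rfl⟩ := hg x
  exact LinearMap.congr_fun h y

/-- Every right linear functional on the dual of `A^k` is an evaluation. -/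
lemma exists_eq_dualEval {k : ℕ} (Φ : ((Fin k → A) →ₗ[A] A) →ₗ[Aᵐᵒᵖ] A) :
    ∃ q, Φ = dualEval q := by
  refine ⟨fun i => Φ (LinearMap.proj i), LinearMap.ext fun φ => ?_⟩
  have h : φ = ∑ i, MulOpposite.op (φ (Pi.single i 1)) • LinearMap.proj i := by
    refine LinearMap.pi_ext' fun i => LinearMap.ext_ring ?_
    simp [Finset.sum_apply, Pi.single_apply]
  have h2 : (fun i => Φ (LinearMap.proj i)) =
      ∑ i, Φ (LinearMap.proj i) • (Pi.single i (1 : A) : Fin k → A) := by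
    ext i
    simp [Finset.sum_apply, Pi.single_apply]
  conv_lhs => rw [h]
  change _ = φ (fun i => Φ (LinearMap.proj i))
  rw [h2]
  simp [map_sum]

/-- Over a ring whose right injective dimension is finite, a semi-Gorenstein projective module is
torsionless. -/
lemma IsSemiGorensteinProjective.eq_zero_of_forall_dual [IsNoetherianRing A] {m : ℕ}
    (hA : HasInjectiveDimensionLE (ModuleCat.of Aᵐᵒᵖ A) m) {X : Type u}
    [AddCommGroup X] [Module A X] (hX : IsSemiGorensteinProjective A X) (x : X)
    (hx : ∀ φ : X →ₗ[A] A, φ x = 0) : x = 0 := by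
  choose! syz hsyz using fun (Z : ModuleCat.{u} A) (hZ : IsSemiGorensteinProjective A Z) =>
    hZ.exists_isSyzygyOf
  let Z : ℕ → ModuleCat.{u} A := fun j => syz^[j] (ModuleCat.of A X)
  have hZsucc : ∀ j, Z (j + 1) = syz (Z j) := fun j => Function.iterate_succ_apply' ..
  have hZ : ∀ j, IsSemiGorensteinProjective A (Z j) := by
    intro j
    induction j with
    | zero => exact hX
    | succ j ih => rw [hZsucc]; exact (hsyz _ ih).1
  have hstep : ∀ j, IsSyzygyOf A (Z (j + 1)) (Z j) := fun j => by
    rw [hZsucc]; exact (hsyz _ (hZ j)).2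
  choose k inc pr hs hext using hstep
  -- the dual of the free resolution, a sequence of projective right modules
  let F : ℕ → ModuleCat.{u} Aᵐᵒᵖ := fun j => ModuleCat.of Aᵐᵒᵖ ((Fin (k j) → A) →ₗ[A] A)
  let d : ∀ j, F j →ₗ[Aᵐᵒᵖ] F (j + 1) := fun j => dualMapOp (inc j ∘ₗ pr (j + 1))
  have hexact : ∀ j, Function.Exact (d j) (d (j + 1)) := by
    intro j (φ : (Fin (k (j + 1)) → A) →ₗ[A] A)
    constructor
    · intro h
      have h0 : φ ∘ₗ inc (j + 1) = 0 := by
        ext z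
        obtain ⟨y, rfl⟩ := (hs (j + 2)).surjective z
        exact LinearMap.congr_fun h y
      obtain ⟨φ', hφ'⟩ := (hs (j + 1)).exists_desc φ h0
      obtain ⟨ψ, hψ⟩ := hext j φ'
      refine ⟨ψ, ?_⟩
      rw [← hφ', ← hψ]
      rfl
    · rintro ⟨ψ, rfl⟩
      refine LinearMap.ext fun y => ?_
      change ψ (inc j (pr (j + 1) (inc (j + 1) _))) = 0
      rw [(hs (j + 1)).exact.apply_apply_eq_zero, map_zero, map_zero]
  obtain ⟨p, hp⟩ := (hs 0).surjective x
  -- evaluation at a preimage `p` of `x` kills the maps which factor through `X`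
  obtain ⟨Φ, hΦ⟩ := exists_extension_of_hasInjectiveDimensionLE m _ hA F d
    (fun j => inferInstanceAs (Module.Projective Aᵐᵒᵖ ((Fin (k j) → A) →ₗ[A] A))) hexact
    (dualEval p) (by
      intro (φ : (Fin (k 0) → A) →ₗ[A] A) h
      have h0 : φ ∘ₗ inc 0 = 0 := by
        ext z
        obtain ⟨y, rfl⟩ := (hs 1).surjective z
        exact LinearMap.congr_fun h y
      obtain ⟨φ', hφ'⟩ := (hs 0).exists_desc φ h0
      change φ p = 0
      rw [← hφ', LinearMap.comp_apply, hp]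
      exact hx φ')
  obtain ⟨q, rfl⟩ := exists_eq_dualEval Φ
  have hpq : p = inc 0 (pr 1 q) := by
    ext i
    exact (LinearMap.congr_fun hΦ (LinearMap.proj i : (Fin (k 0) → A) →ₗ[A] A)).symm
  rw [← hp, hpq]
  exact (hs 0).exact.apply_apply_eq_zero _

lemma IsSemiGorensteinProjective.exists_isSyzygyOf_right (hA : IsGorensteinRing A) {X : Type u}
    [AddCommGroup X] [Module A X] (hX : IsSemiGorensteinProjective A X) :
    ∃ Z : ModuleCat.{u} A, IsSemiGorensteinProjective A Z ∧ IsSyzygyOf A X Z := by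
  have := hA.noetherian_left
  have := hA.noetherian_right
  have := hX.finite
  obtain ⟨m, hm⟩ := hA.injdim_right
  have : IsNoetherian Aᵐᵒᵖ (X →ₗ[A] A) := isNoetherian_dual
  obtain ⟨k, s, hs⟩ := Module.Finite.exists_fin' Aᵐᵒᵖ (X →ₗ[A] A)
  -- the generators of the dual of `X` are the components of a map `X → A^k`
  let f : X →ₗ[A] (Fin k → A) := LinearMap.pi fun i => s (Pi.single i 1)
  have hext : ∀ φ : X →ₗ[A] A, ∃ ψ : (Fin k → A) →ₗ[A] A, ψ ∘ₗ f = φ := by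
    intro φ
    obtain ⟨c, rfl⟩ := hs φ
    refine ⟨∑ i, c i • LinearMap.proj i, ?_⟩
    have hc : c = ∑ i, c i • (Pi.single i (1 : Aᵐᵒᵖ) : Fin k → Aᵐᵒᵖ) := by
      ext i
      simp [Finset.sum_apply, Pi.single_apply]
    conv_rhs => rw [hc]
    ext x
    simp [f, LinearMap.sum_apply, map_sum]
  have hf : Function.Injective f := by
    refine (injective_iff_map_eq_zero f).2 fun x hx => ?_
    refine hX.eq_zero_of_forall_dual hm x fun φ => ?_
    obtain ⟨ψ, rfl⟩ := hext φ
    rw [LinearMap.comp_apply, hx, map_zero]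
  have hses := isShortExactSeq_range_mkQ hf
  exact ⟨ModuleCat.of A ((Fin k → A) ⧸ LinearMap.range f),
    ⟨inferInstance, hses.extVanishesAbove_right_zero hX.ext (.of_projective 0) hext⟩,
    k, f, _, hses, hext⟩

lemma exists_extension_of_projective {X P : Type u} [AddCommGroup X] [Module A X]
    [AddCommGroup P] [Module A P] {f : X →ₗ[A] P}
    (hext : ∀ φ : X →ₗ[A] A, ∃ ψ : P →ₗ[A] A, ψ ∘ₗ f = φ)
    (Q : Type u) [AddCommGroup Q] [Module A Q] [Module.Finite A Q] [Module.Projective A Q]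
    (φ : X →ₗ[A] Q) : ∃ ψ : P →ₗ[A] Q, ψ ∘ₗ f = φ := by
  obtain ⟨k, g, hg⟩ := Module.Finite.exists_fin' A Q
  obtain ⟨s, hs⟩ := Module.projective_lifting_property g LinearMap.id hg
  choose ψ hψ using fun i => hext (LinearMap.proj i ∘ₗ s ∘ₗ φ)
  refine ⟨g ∘ₗ LinearMap.pi ψ, ?_⟩
  have : LinearMap.pi ψ ∘ₗ f = s ∘ₗ φ := by
    ext x i
    exact LinearMap.congr_fun (hψ i) x
  rw [LinearMap.comp_assoc, this, ← LinearMap.comp_assoc, hs, LinearMap.id_comp]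

/-- A two-sided sequence of syzygies gives a complete projective resolution. -/
lemma isGorensteinProjective_of_isSyzygyOf (Z : ℤ → ModuleCat.{u} A)
    (h : ∀ i, IsSyzygyOf A (Z i) (Z (i + 1))) : IsGorensteinProjective A (Z 0) := by
  choose k inc pr hs hext using h
  refine ⟨{
    P := fun i => Fin (k i) → A
    finite := fun i => inferInstance
    projective := fun i => inferInstance
    d := fun i => inc (i + 1) ∘ₗ pr i
    exact := ?_
    hom_exact := ?_
    iso := ?_ }⟩
  · intro i y
    constructor
    · intro h
      have h0 : pr (i + 1) y = 0 :=
        (injective_iff_map_eq_zero _).1 (hs (i + 1 + 1)).injective _ h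
      obtain ⟨z, rfl⟩ := ((hs (i + 1)).exact y).1 h0
      obtain ⟨x, rfl⟩ := (hs i).surjective z
      exact ⟨x, rfl⟩
    · rintro ⟨x, rfl⟩
      simp [(hs (i + 1)).exact.apply_apply_eq_zero]
  · intro Q _ _ _ _ i φ
    constructor
    · intro h
      have h0 : φ ∘ₗ inc (i + 1) = 0 := by
        ext z
        obtain ⟨y, rfl⟩ := (hs i).surjective z
        exact LinearMap.congr_fun h y
      obtain ⟨φ', hφ'⟩ := (hs (i + 1)).exists_desc φ h0
      obtain ⟨ψ, hψ⟩ := exists_extension_of_projective (hext (i + 1 + 1)) Q φ'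
      refine ⟨ψ, ?_⟩
      change ψ ∘ₗ _ = _
      rw [← LinearMap.comp_assoc, hψ, hφ']
    · rintro ⟨ψ, rfl⟩
      refine LinearMap.ext fun y => ?_
      simp [(hs (i + 1)).exact.apply_apply_eq_zero]
  · have hr : LinearMap.range (inc (-1 + 1) ∘ₗ pr (-1)) = LinearMap.range (inc (-1 + 1)) :=
      LinearMap.range_comp_of_range_eq_top _ (LinearMap.range_eq_top.2 (hs (-1)).surjective)
    exact (LinearEquiv.ofInjective (inc 0) (hs 0).injective).trans (LinearEquiv.ofEq _ _ hr.symm)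

/-- Over a Gorenstein ring, the vanishing of `Ext^i(X, A)` for all `i > 0` makes `X` Gorenstein
projective. -/
lemma IsSemiGorensteinProjective.isGorensteinProjective (hA : IsGorensteinRing A) {X : Type u}
    [AddCommGroup X] [Module A X] (hX : IsSemiGorensteinProjective A X) :
    IsGorensteinProjective A X := by
  have := hA.noetherian_left
  choose! prev hprev using fun (Z : ModuleCat.{u} A) (hZ : IsSemiGorensteinProjective A Z) =>
    hZ.exists_isSyzygyOf
  choose! next hnext using fun (Z : ModuleCat.{u} A) (hZ : IsSemiGorensteinProjective A Z) =>
    hZ.exists_isSyzygyOf_right hA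
  let X₀ := ModuleCat.of A X
  have hp : ∀ j, IsSemiGorensteinProjective A (prev^[j] X₀) := by
    intro j
    induction j with
    | zero => exact hX
    | succ j ih => rw [Function.iterate_succ_apply']; exact (hprev _ ih).1
  have hn : ∀ j, IsSemiGorensteinProjective A (next^[j] X₀) := by
    intro j
    induction j with
    | zero => exact hX
    | succ j ih => rw [Function.iterate_succ_apply']; exact (hnext _ ih).1
  let Z : ℤ → ModuleCat.{u} A
    | Int.ofNat j => next^[j] X₀
    | Int.negSucc j => prev^[j + 1] X₀
  refine isGorensteinProjective_of_isSyzygyOf Z fun i => ?_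
  match i with
  | Int.ofNat j =>
    change IsSyzygyOf A (next^[j] X₀) (next^[j + 1] X₀)
    rw [Function.iterate_succ_apply']
    exact (hnext _ (hn j)).2
  | Int.negSucc 0 => exact (hprev _ hX).2
  | Int.negSucc (j + 1) =>
    change IsSyzygyOf A (prev^[j + 1 + 1] X₀) (prev^[j + 1] X₀)
    rw [Function.iterate_succ_apply' prev (j + 1)]
    exact (hprev _ (hp _)).2

lemma IsGorensteinProjective.isSemiGorensteinProjective {X : Type u}
    [AddCommGroup X] [Module A X] (hX : IsGorensteinProjective A X) :
    IsSemiGorensteinProjective A X := by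
  obtain ⟨C⟩ := hX
  let := C.addCommGroup
  let := C.module
  have := C.finite
  have := C.projective
  have hses : ∀ i, IsShortExactSeq (LinearMap.range (C.d i)).subtype (C.d (i + 1)).rangeRestrict :=
    fun i => by
      refine ⟨Submodule.injective_subtype _, fun y => ?_, LinearMap.surjective_rangeRestrict _⟩
      have : (C.d (i + 1)).rangeRestrict y = 0 ↔ C.d (i + 1) y = 0 := Subtype.ext_iff
      rw [this, C.exact i y]
      simp
  have hext : ∀ (n : ℕ) (i : ℤ) (e : Abelian.Ext (ModuleCat.of A (LinearMap.range (C.d i)))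
      (ModuleCat.of A A) (n + 1)), e = 0 := by
    intro n
    induction n with
    | zero =>
      intro i
      obtain ⟨i, rfl⟩ : ∃ j, i = j + 1 + 1 := ⟨i - 2, by ring⟩
      refine (hses (i + 1)).ext_one_eq_zero (.of_projective 0) fun φ => ?_
      obtain ⟨ψ, hψ⟩ := (C.hom_exact A i (φ ∘ₗ (C.d (i + 1)).rangeRestrict)).1 (by
        ext x
        have : (C.d (i + 1)).rangeRestrict (C.d i x) = 0 :=
          Subtype.ext ((C.exact i).apply_apply_eq_zero x)
        simp [this])
      refine ⟨ψ, LinearMap.ext fun ⟨_, x, rfl⟩ => ?_⟩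
      exact LinearMap.congr_fun hψ x
    | succ n ih =>
      intro i
      obtain ⟨i, rfl⟩ : ∃ j, i = j + 1 := ⟨i - 1, by ring⟩
      exact (hses i).ext_succ_eq_zero (.of_projective 0) (ih i)
  refine ⟨.equiv C.iso.symm, ExtVanishesAbove.of_equiv_left C.iso.symm fun i hi => ?_⟩
  obtain ⟨j, rfl⟩ : ∃ j, i = j + 1 := ⟨i - 1, by lia⟩
  exact hext j (-1)

end

/-! ### Gorenstein projective approximations -/

/-- `Y` has a resolution `0 → A^k_{d-1} → ⋯ → A^k_0 → Y → 0` by `d` finitely generated free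
modules, so that `d = 0` means `Y = 0`. -/
inductive HasFreeResolutionOfLength (A : Type u) [Ring A] : ℕ → ModuleCat.{u} A → Prop
  | zero (Y : ModuleCat.{u} A) (h : Subsingleton Y) : HasFreeResolutionOfLength A 0 Y
  | succ {d : ℕ} {Y Y' : ModuleCat.{u} A} {k : ℕ} (f : Y →ₗ[A] (Fin k → A))
      (g : (Fin k → A) →ₗ[A] Y') (hfg : IsShortExactSeq f g)
      (h : HasFreeResolutionOfLength A d Y) : HasFreeResolutionOfLength A (d + 1) Y'

section

variable {A : Type u} [Ring A]

lemma HasFreeResolutionOfLength.extVanishesAbove {d : ℕ} {Y : ModuleCat.{u} A}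
    (h : HasFreeResolutionOfLength A d Y) {X : Type u} [AddCommGroup X] [Module A X]
    (hX : ExtVanishesAbove A X A 0) : ExtVanishesAbove A X Y 0 := by
  induction h with
  | zero Y h => exact .of_subsingleton_right 0
  | succ f g hfg _ ih => exact hfg.extVanishesAbove_target_right ih (hX.pi_right _)

/-- The Gorenstein projective approximation of a module `K` with `Ext^i(K, A) = 0` for `i > d`. In
the inductive step, the approximation `0 → Y → G → Ω → 0` of a syzygy `Ω` of `K` and a sequence
`0 → G → A^k → G' → 0` yield an approximation of `K` by `G' ⊕ A^l` with kernel `A^k / Y`. -/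
lemma exists_approximation (hA : IsGorensteinRing A) (d : ℕ) :
    ∀ (K : ModuleCat.{u} A) (_ : Module.Finite A K) (_ : ExtVanishesAbove A K A d),
      ∃ (Y G : ModuleCat.{u} A) (f : Y →ₗ[A] G) (g : G →ₗ[A] K), IsShortExactSeq f g ∧
        HasFreeResolutionOfLength A d Y ∧ IsSemiGorensteinProjective A G := by
  induction d with
  | zero =>
    intro K hK hext
    refine ⟨ModuleCat.of A PUnit, K, 0, LinearMap.id, ⟨fun _ _ _ => rfl, fun x => ?_, fun x =>
      ⟨x, rfl⟩⟩, .zero _ inferInstance, hK, hext⟩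
    simp [eq_comm]
  | succ d ih =>
    intro K hK hext
    have := hA.noetherian_left
    obtain ⟨l, p, hp⟩ := Module.Finite.exists_fin' A K
    have hs := isShortExactSeq_ker_subtype hp
    obtain ⟨Y, G, j, q, hjq, hY, hG⟩ := ih (ModuleCat.of A (LinearMap.ker p)) inferInstance
      (hs.extVanishesAbove_left (.of_projective d) hext)
    obtain ⟨G', hG', k, i, r, hir, hi⟩ := hG.exists_isSyzygyOf_right hA
    obtain ⟨φ, hφ⟩ := exists_extension_of_projective hi (Fin l → A)
      ((LinearMap.ker p).subtype ∘ₗ q)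
    replace hφ : ∀ x, φ (i x) = q x := LinearMap.congr_fun hφ
    -- `φ` induces a morphism from `0 → G → A^k → G' → 0` to `0 → ker p → A^l → K → 0`
    obtain ⟨ψ, hψ⟩ := hir.exists_desc (p ∘ₗ φ) (by
      ext x
      simp [hφ])
    replace hψ : ∀ x, ψ (r x) = p (φ x) := LinearMap.congr_fun hψ
    let g : (G' × (Fin l → A)) →ₗ[A] K := ψ.coprod p
    have hg : ∀ x, g x = ψ x.1 + p x.2 := fun x => rfl
    have hgs : Function.Surjective g := fun x => by
      obtain ⟨y, rfl⟩ := hp x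
      exact ⟨(0, y), by simp [hg]⟩
    let t : (Fin k → A) →ₗ[A] LinearMap.ker g := (r.prod (-φ)).codRestrict _ fun x => by
      simp [hg, hψ]
    have ht : ∀ x, (t x : G' × (Fin l → A)) = (r x, -φ x) := fun x => rfl
    refine ⟨ModuleCat.of A (LinearMap.ker g), ModuleCat.of A (G' × (Fin l → A)),
      (LinearMap.ker g).subtype, g, isShortExactSeq_ker_subtype hgs,
      .succ (i ∘ₗ j) t ⟨hir.injective.comp hjq.injective, fun x => ⟨fun hx => ?_, ?_⟩, ?_⟩ hY, ?_⟩
    · have h0 : (r x, -φ x) = 0 := (ht x).symm.trans (congrArg Subtype.val hx)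
      obtain ⟨y, rfl⟩ := (hir.exact x).1 (congrArg Prod.fst h0)
      have h1 : φ (i y) = 0 := neg_eq_zero.1 (congrArg Prod.snd h0)
      rw [hφ] at h1
      obtain ⟨z, rfl⟩ := (hjq.exact y).1 (Subtype.ext h1)
      exact ⟨z, rfl⟩
    · rintro ⟨z, rfl⟩
      refine Subtype.ext ?_
      rw [ht]
      simp [hφ, hir.exact.apply_apply_eq_zero, hjq.exact.apply_apply_eq_zero]
    · rintro ⟨⟨x, y⟩, hxy⟩
      obtain ⟨x, rfl⟩ := hir.surjective x
      replace hxy : ψ (r x) + p y = 0 := hxy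
      rw [hψ, ← map_add] at hxy
      obtain ⟨z, hz⟩ := hjq.surjective ⟨φ x + y, hxy⟩
      refine ⟨x - i z, Subtype.ext ?_⟩
      rw [ht]
      simp [hφ, hz, hir.exact.apply_apply_eq_zero]
    · have := hG'.finite
      have hsplit : IsShortExactSeq (LinearMap.inl A G' (Fin l → A))
          (LinearMap.snd A G' (Fin l → A)) :=
        ⟨LinearMap.inl_injective, .inl_snd, LinearMap.snd_surjective⟩
      exact ⟨inferInstanceAs (Module.Finite A (G' × (Fin l → A))),
        hsplit.extVanishesAbove_middle hG'.ext (.of_projective 0)⟩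

end

/-! ### The functor `Hom_A(M, -)` and ideals of the endomorphism ring -/

/-- The `NonAssocSemiring` structure on `Sᵈᵐᵃ` found by default agrees with the one underlying its
`Semiring` structure only after unfolding. Linear maps over `Sᵈᵐᵃ` refer to the latter, which is
therefore given priority. -/
local instance (priority := 2000) {S : Type u} [Semiring S] : NonAssocSemiring (DomMulAct S) :=
  Semiring.toNonAssocSemiring

section

variable {A : Type u} [Ring A] (M : Type u) [AddCommGroup M] [Module A M]
  {X Y Z : Type u} [AddCommGroup X] [Module A X] [AddCommGroup Y] [Module A Y]
  [AddCommGroup Z] [Module A Z]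

/-- The functor `Hom_A(M, -)` to left modules over `RightEnd A M`, on morphisms. -/
def homPostcomp (f : X →ₗ[A] Y) : (M →ₗ[A] X) →ₗ[RightEnd A M] (M →ₗ[A] Y) where
  toFun h := f ∘ₗ h
  map_add' h h' := LinearMap.comp_add h h' f
  map_smul' _ _ := rfl

@[simp] lemma homPostcomp_apply (f : X →ₗ[A] Y) (h : M →ₗ[A] X) :
    homPostcomp M f h = f ∘ₗ h := rfl

/-- The comparison map `Hom_A(M, E)^k → Hom_A(M, E^k)` of left `RightEnd A M`-modules. -/
def homPi (E : Type u) [AddCommGroup E] [Module A E] (k : ℕ) :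
    (Fin k → (M →ₗ[A] E)) →ₗ[RightEnd A M] (M →ₗ[A] (Fin k → E)) where
  toFun c := LinearMap.pi c
  map_add' _ _ := rfl
  map_smul' _ _ := rfl

lemma IsShortExactSeq.homPostcomp {M : Type u} [AddCommGroup M] [Module A M] {f : X →ₗ[A] Y}
    {g : Y →ₗ[A] Z} (h : IsShortExactSeq f g) (hM : ExtVanishesAbove A M X 0) :
    IsShortExactSeq (homPostcomp M f) (homPostcomp M g) := by
  refine ⟨fun φ ψ hφψ => ?_, fun φ => ⟨fun hφ => h.exists_lift φ hφ, ?_⟩,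
    fun φ => h.exists_lifting hM φ⟩
  · ext x
    exact h.injective (LinearMap.congr_fun hφψ x)
  · rintro ⟨ψ, rfl⟩
    ext x
    exact h.exact.apply_apply_eq_zero _

lemma IsInAdd.hasProjectiveDimensionLT_hom {E : Type u} [AddCommGroup E] [Module A E]
    (hX : IsInAdd A E X) {m : ℕ}
    (h : HasProjectiveDimensionLT (ModuleCat.of (RightEnd A M) (M →ₗ[A] E)) m) :
    HasProjectiveDimensionLT (ModuleCat.of (RightEnd A M) (M →ₗ[A] X)) m := by
  obtain ⟨k, Y, ⟨e⟩⟩ := hX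
  have := hasProjectiveDimensionLT_pi h k
  let r : Retract (ModuleCat.of (RightEnd A M) (M →ₗ[A] X))
      (ModuleCat.of (RightEnd A M) (Fin k → (M →ₗ[A] E))) :=
    { i := ModuleCat.ofHom (LinearMap.pi fun i =>
        homPostcomp M (LinearMap.proj i ∘ₗ e.toLinearMap ∘ₗ LinearMap.inl A X Y))
      r := ModuleCat.ofHom (homPostcomp M (LinearMap.fst A X Y ∘ₗ e.symm.toLinearMap) ∘ₗ
        homPi M E k)
      retract := by
        ext φ : 2
        refine LinearMap.ext fun x => ?_
        change (e.symm (e (φ x, 0))).1 = φ x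
        simp }
  exact r.hasProjectiveDimensionLT m

lemma HasFreeResolutionOfLength.hasProjectiveDimensionLT_hom {q : ℕ}
    (hM : ExtVanishesAbove A M A 0)
    (hq : ∀ k : ℕ, HasProjectiveDimensionLE
      (ModuleCat.of (RightEnd A M) (M →ₗ[A] (Fin k → A))) q)
    {d : ℕ} {Y : ModuleCat.{u} A} (h : HasFreeResolutionOfLength A d Y) :
    HasProjectiveDimensionLT (ModuleCat.of (RightEnd A M) (M →ₗ[A] Y)) (q + d) := by
  induction h with
  | zero Y h =>
    have : Subsingleton (M →ₗ[A] Y) := ⟨fun φ ψ => LinearMap.ext fun x => h.elim _ _⟩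
    have : HasProjectiveDimensionLT (ModuleCat.of (RightEnd A M) (M →ₗ[A] Y)) 0 :=
      (ModuleCat.isZero_of_subsingleton _).hasProjectiveDimensionLT_zero
    exact hasProjectiveDimensionLT_of_ge _ 0 _ (by lia)
  | @succ d Y Y' k f g hfg h ih =>
    have := hq k
    exact (hfg.homPostcomp (h.extVanishesAbove hM)).hasProjectiveDimensionLT_right ih
      (hasProjectiveDimensionLT_of_ge _ (q + 1) _ (by lia))

/-- The approximation of `K` stays exact under `Hom_A(M, -)`, as `Ext^1(M, -)` vanishes on its
kernel. -/
lemma hasProjectiveDimensionLE_hom_of_extVanishesAbove (hA : IsGorensteinRing A)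
    (hM : IsSemiGorensteinProjective A M) {q : ℕ}
    (hq : ∀ G : ModuleCat.{u} A, IsSemiGorensteinProjective A G →
      HasProjectiveDimensionLE (ModuleCat.of (RightEnd A M) (M →ₗ[A] G)) q)
    {d : ℕ} (K : ModuleCat.{u} A) [Module.Finite A K] (hK : ExtVanishesAbove A K A d) :
    HasProjectiveDimensionLE (ModuleCat.of (RightEnd A M) (M →ₗ[A] K)) (q + d) := by
  obtain ⟨Y, G, f, g, hfg, hY, hG⟩ := exists_approximation hA d K inferInstance hK
  have := hq G hG
  refine (hfg.homPostcomp (hY.extVanishesAbove hM.ext)).hasProjectiveDimensionLT_right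
    (hY.hasProjectiveDimensionLT_hom M hM.ext fun k =>
      hq (ModuleCat.of A (Fin k → A)) (isSemiGorensteinProjective_pi k))
    (hasProjectiveDimensionLT_of_ge _ (q + 1) _ (by lia))

/-- The endomorphism ring of a finitely generated module over a module-finite algebra over a
commutative Noetherian ring is Noetherian; here its regular module is realized as `Hom_A(M, M)`. -/
lemma fg_submodule_end (R : Type w) [CommRing R] [IsNoetherianRing R] [Algebra R A]
    [Module.Finite R A] [Module.Finite A M] (N : Submodule (RightEnd A M) (M →ₗ[A] M)) :
    N.FG := by
  let : Module R M := Module.compHom M (algebraMap R A)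
  have hsmul : ∀ (r : R) (x : M), r • x = algebraMap R A r • x := fun _ _ => rfl
  have : IsScalarTower R A M := ⟨fun r a x => by rw [hsmul, Algebra.smul_def, mul_smul]⟩
  have : SMulCommClass A R M := ⟨fun a r x => by
    rw [hsmul, hsmul, smul_smul, smul_smul, Algebra.commutes]⟩
  have : Module.Finite R M := .trans A M
  obtain ⟨k, g, hg⟩ := Module.Finite.exists_fin' A M
  let ev : (M →ₗ[A] M) →ₗ[R] (Fin k → M) :=
    { toFun := fun φ i => φ (g (Pi.single i 1))
      map_add' := fun _ _ => rfl
      map_smul' := fun _ _ => rfl }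
  have : IsNoetherian R (M →ₗ[A] M) := by
    refine isNoetherian_of_injective ev fun φ ψ h => ?_
    have : φ ∘ₗ g = ψ ∘ₗ g := LinearMap.pi_ext' fun i => LinearMap.ext_ring (congrFun h i)
    ext x
    obtain ⟨y, rfl⟩ := hg x
    exact LinearMap.congr_fun this y
  let N' : Submodule R (M →ₗ[A] M) :=
    { toAddSubmonoid := N.toAddSubmonoid
      smul_mem' := fun r φ hφ => by
        have : r • φ = (DomMulAct.mk (r • (LinearMap.id : M →ₗ[A] M)) : RightEnd A M) • φ := by
          ext x
          change r • φ x = φ (r • x)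
          rw [hsmul, hsmul, map_smul]
        rw [this]
        exact N.smul_mem _ hφ }
  obtain ⟨s, hs⟩ := IsNoetherian.noetherian N'
  have hsN : ∀ φ ∈ s, φ ∈ N := fun φ hφ =>
    show φ ∈ N' from hs ▸ Submodule.subset_span hφ
  refine ⟨s, le_antisymm (Submodule.span_le.2 hsN) fun φ hφ => ?_⟩
  replace hφ : φ ∈ Submodule.span R (s : Set (M →ₗ[A] M)) := hs ▸ (show φ ∈ N' from hφ)
  induction hφ using Submodule.span_induction with
  | mem φ h => exact Submodule.subset_span h
  | zero => exact Submodule.zero_mem _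
  | add _ _ _ _ h h' => exact Submodule.add_mem _ h h'
  | smul r φ _ h =>
    have : r • φ = (DomMulAct.mk (r • (LinearMap.id : M →ₗ[A] M)) : RightEnd A M) • φ := by
      ext x
      change r • φ x = φ (r • x)
      rw [hsmul, hsmul, map_smul]
    rw [this]
    exact Submodule.smul_mem _ _ h

/-- The regular left module of `RightEnd A M` is `Hom_A(M, M)`. -/
def rightEndEquiv (A : Type u) [Ring A] (M : Type u) [AddCommGroup M] [Module A M] :
    RightEnd A M ≃ₗ[RightEnd A M] (M →ₗ[A] M) where
  toFun := DomMulAct.mk.symm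
  invFun := DomMulAct.mk
  map_add' _ _ := rfl
  map_smul' _ _ := rfl

/-- Let `N` be a finitely generated left ideal of `RightEnd A M = Hom_A(M, M)`. Its generators
define a map `M^k → M` such that `Hom_A(M, M^k) → Hom_A(M, M)` has image `N`. -/
lemma exists_isShortExactSeq_of_fg (N : Submodule (RightEnd A M) (M →ₗ[A] M)) (hN : N.FG) :
    ∃ (k : ℕ) (β : (Fin k → M) →ₗ[A] M) (p : (M →ₗ[A] (Fin k → M)) →ₗ[RightEnd A M] N),
      IsShortExactSeq (homPostcomp M (LinearMap.ker β).subtype) p := by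
  obtain ⟨k, s, hs⟩ := Submodule.fg_iff_exists_fin_generating_family.1 hN
  let β : (Fin k → M) →ₗ[A] M := ∑ i, s i ∘ₗ LinearMap.proj i
  have hβ : ∀ h : M →ₗ[A] (Fin k → M), β ∘ₗ h =
      ∑ i, (DomMulAct.mk (LinearMap.proj i ∘ₗ h) : RightEnd A M) • s i := by
    intro h
    ext x
    simp only [β, LinearMap.comp_apply, LinearMap.sum_apply]
    rfl
  have hmem : ∀ h, homPostcomp M β h ∈ N := by
    intro h
    rw [homPostcomp_apply, hβ, ← hs]
    exact Submodule.sum_mem _ fun i _ => Submodule.smul_mem _ _ (Submodule.subset_span ⟨i, rfl⟩)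
  refine ⟨k, β, (homPostcomp M β).codRestrict N hmem, fun φ ψ h => ?_,
    fun φ => ⟨fun h => ?_, ?_⟩, ?_⟩
  · ext x : 1
    exact Subtype.ext (LinearMap.congr_fun h x)
  · have h0 : β ∘ₗ φ = 0 := congrArg Subtype.val h
    exact ⟨φ.codRestrict _ (LinearMap.congr_fun h0), rfl⟩
  · rintro ⟨ψ, rfl⟩
    refine Subtype.ext (LinearMap.ext fun x => ?_)
    exact (ψ x).2
  · rintro ⟨φ, hφ⟩
    rw [← hs, Submodule.mem_span_range_iff_exists_fun] at hφ
    obtain ⟨c, hc⟩ := hφ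
    refine ⟨LinearMap.pi fun i => DomMulAct.mk.symm (c i), Subtype.ext ?_⟩
    exact (hβ _).trans hc

lemma hasProjectiveDimensionLE_quotient_of_fg {d : ℕ} (hA : IsNGorensteinRing (d + 2) A)
    (hM : IsSemiGorensteinProjective A M) {q : ℕ}
    (hq : ∀ G : ModuleCat.{u} A, IsSemiGorensteinProjective A G →
      HasProjectiveDimensionLE (ModuleCat.of (RightEnd A M) (M →ₗ[A] G)) q)
    (N : Submodule (RightEnd A M) (M →ₗ[A] M)) (hN : N.FG) :
    HasProjectiveDimensionLE (ModuleCat.of (RightEnd A M) ((M →ₗ[A] M) ⧸ N)) (q + d + 2) := by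
  have := hA.noetherian_left
  have := hM.finite
  obtain ⟨k, β, p, hp⟩ := exists_isShortExactSeq_of_fg M N hN
  have hMk : IsSemiGorensteinProjective A (Fin k → M) := ⟨inferInstance, hM.ext.pi_left k⟩
  -- the kernel of `β` is a second syzygy of its cokernel
  have hrange : ExtVanishesAbove A (LinearMap.range β) A (d + 1) :=
    (isShortExactSeq_subtype_mkQ (LinearMap.range β)).extVanishesAbove_left
      (hM.ext.mono (by lia)) (.of_injdim hA.injdim_le)
  have hker : ExtVanishesAbove A (LinearMap.ker β) A d := by
    have hs := isShortExactSeq_ker_subtype β.surjective_rangeRestrict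
    rw [LinearMap.ker_rangeRestrict] at hs
    exact hs.extVanishesAbove_left (hMk.ext.mono (by lia)) hrange
  have h₁ := hasProjectiveDimensionLE_hom_of_extVanishesAbove M hA.toIsGorensteinRing hM hq
    (ModuleCat.of A (LinearMap.ker β)) hker
  have h₂ := hq (ModuleCat.of A (Fin k → M)) hMk
  have h₃ := hq (ModuleCat.of A M) hM
  have h₄ := hp.hasProjectiveDimensionLT_right h₁
    (hasProjectiveDimensionLT_of_ge _ (q + 1) _ (by lia))
  exact (isShortExactSeq_subtype_mkQ N).hasProjectiveDimensionLT_right h₄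
    (hasProjectiveDimensionLT_of_ge _ (q + 1) _ (by lia))

lemma IsInAdd.subsingleton {E : Type u} [AddCommGroup E] [Module A E] (hM : IsInAdd A E M)
    [Subsingleton (M →ₗ[A] E)] : Subsingleton M := by
  obtain ⟨k, Y, ⟨e⟩⟩ := hM
  refine ⟨fun x y => ?_⟩
  have h : ∀ x : M, e (x, 0) = 0 := fun x => by
    ext i
    exact LinearMap.congr_fun (Subsingleton.elim
      (LinearMap.proj i ∘ₗ e.toLinearMap ∘ₗ LinearMap.inl A M Y) 0) x
  exact congrArg Prod.fst (e.injective ((h x).trans (h y).symm))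

end

theorem theorem3p2 {R : Type w} [CommRing R] [IsArtinianRing R]
    {A : Type u} [Ring A] [Algebra R A] [Module.Finite R A]
    (n : ℕ) (hn : 2 ≤ n) (hA : IsNGorensteinRing n A)
    (E : Type u) [AddCommGroup E] [Module A E] [Module.Finite A E]
    (hE : GorensteinProjectivesEqAdd A E)
    (M : Type u) [AddCommGroup M] [Module A M] (hM : IsGorensteinProjective A M) :
    globalDimension (RightEnd A M) ≤
      (n : WithBot ℕ∞) + projectiveDimension (ModuleCat.of (RightEnd A M) (M →ₗ[A] E)) := by
  have hM' := hM.isSemiGorensteinProjective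
  have hMfin := hM'.finite
  obtain ⟨d, rfl⟩ : ∃ d, n = d + 2 := ⟨n - 2, by lia⟩
  generalize hp : projectiveDimension (ModuleCat.of (RightEnd A M) (M →ₗ[A] E)) = p
  induction p with
  | bot =>
    -- `Hom_A(M, E) = 0` forces `M = 0`, so that `RightEnd A M` is the zero ring
    have : Subsingleton (M →ₗ[A] E) :=
      ModuleCat.subsingleton_of_isZero ((projectiveDimension_eq_bot_iff _).1 hp)
    have : Subsingleton M := ((hE M).1 hM).subsingleton
    have : Subsingleton (RightEnd A M) := (rightEndEquiv A M).injective.subsingleton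
    refine iSup_le fun X => ?_
    have : Subsingleton X := Module.subsingleton (RightEnd A M) X
    rw [(projectiveDimension_eq_bot_iff X).2 (ModuleCat.isZero_of_subsingleton X)]
    exact bot_le
  | coe p =>
    induction p with
    | top =>
      refine le_top.trans_eq ?_
      rfl
    | coe q =>
      have hq : HasProjectiveDimensionLE (ModuleCat.of (RightEnd A M) (M →ₗ[A] E)) q :=
        (projectiveDimension_le_iff _ q).1 hp.le
      have hG : ∀ G : ModuleCat.{u} A, IsSemiGorensteinProjective A G →
          HasProjectiveDimensionLE (ModuleCat.of (RightEnd A M) (M →ₗ[A] G)) q := fun G hG =>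
        have := hG.finite
        ((hE G).1 (hG.isGorensteinProjective hA.toIsGorensteinRing)).hasProjectiveDimensionLT_hom
          M hq
      have key : globalDimension (RightEnd A M) ≤ ((q + d + 2 : ℕ) : WithBot ℕ∞) := by
        exact globalDimension_le_of_cyclic (rightEndEquiv A M) _ fun N =>
          hasProjectiveDimensionLE_quotient_of_fg M hA hM' hG N (fg_submodule_end M R N)
      refine key.trans_eq ?_
      rw [show q + d + 2 = d + 2 + q by lia, Nat.cast_add]
      rfl
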